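/- **Theorem.** For every real $p>0$ there exist $c>0$ and $N\in\mathbb{N}$ such that the following holds for every finite field $\mathbb{F}_q$, every $n\ge N$ and every nonzero $b\in\mathbb{F}_q^n$. Suppose a quantum algorithm, which may depend on $b$, makes $t$ queries to a matrix $A\in\mathbb{F}_q^{n\times n}$ through the matrix-vector oracle $|x,y\rangle\mapsto|x,y+Ax\rangle$ ($x,y\in\mathbb{F}_q^n$), and for every invertible $A$ outputs the solution $x$ of $Ax=b$ with probability at least $p$. Then $t\ge cn$. In particular (taking $p=2/3$), the bounded-error matrix-vector quantum query complexity of solving an $n\times n$ linear system over $\mathbb{F}_q$ is $\Omega(n)$. Here a $t$-query algorithm starts in a fixed computational basis state of the query register, the answer register and a finite workspace, applies $U_t O_A U_{t-1} O_A\cdots O_A U_0$, where $O_A$ is the oracle (acting as the identity on the workspace) and $U_0,\dots,U_t$ are unitaries independent of $A$, measures in the computational basis, and outputs a function of the result. -/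

import Mathlib

open scoped Matrix

namespace QuantumQuery

/-- Computational basis labels `|x, y, w⟩`: query register `x ∈ X`, answer register `y ∈ G`,
and a finite workspace of arbitrary dimension `k`. -/
abbrev BasisLabel (X G : Type*) (k : ℕ) : Type _ := X × G × Fin k

/-- The standard query to `f : X → G`, tensored with the identity on the workspace:
`|x, y, w⟩ ↦ |x, y + f x, w⟩`. The entry at `(i, j)` is the amplitude of `|i⟩` in the image
of `|j⟩`. -/
def oracle {X G : Type*} [DecidableEq X] [DecidableEq G] [Add G] {k : ℕ} (f : X → G) :
    Matrix (BasisLabel X G k) (BasisLabel X G k) ℂ :=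
  fun i j => if i = (j.1, j.2.1 + f j.1, j.2.2) then 1 else 0

/-- A quantum query algorithm for functions `X → G` with outputs in `Ω`: it starts in a
computational basis state, applies input-independent unitaries interleaved with `queries`
standard queries, measures in the computational basis, and outputs a function of the result. -/
structure Algorithm (X G Ω : Type*) [Fintype X] [DecidableEq X] [Fintype G] [DecidableEq G] where
  /-- Number of queries. -/
  queries : ℕ
  /-- Dimension of the workspace. -/
  workDim : ℕ
  /-- The initial basis state. -/
  start : BasisLabel X G workDim
  /-- The unitaries; only those with index at most `queries` are used. -/
  gate : ℕ → Matrix.unitaryGroup (BasisLabel X G workDim) ℂ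
  /-- Classical post-processing of the measurement result. -/
  output : BasisLabel X G workDim → Ω

namespace Algorithm

variable {X G Ω : Type*} [Fintype X] [DecidableEq X] [Fintype G] [DecidableEq G]

/-- The state `U_s O_f U_{s-1} O_f ⋯ O_f U_0 |start⟩` reached after `s` queries to `f`. -/
def state [Add G] (𝒜 : Algorithm X G Ω) (f : X → G) : ℕ → BasisLabel X G 𝒜.workDim → ℂ
  | 0 => (𝒜.gate 0 : Matrix _ _ ℂ) *ᵥ Pi.single 𝒜.start 1
  | s + 1 => (𝒜.gate (s + 1) : Matrix _ _ ℂ) *ᵥ (oracle f *ᵥ state 𝒜 f s)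

/-- The probability that the algorithm, run with query access to `f`, outputs `o`. -/
noncomputable def outputProb [Add G] [DecidableEq Ω] (𝒜 : Algorithm X G Ω) (f : X → G) (o : Ω) :
    ℝ :=
  ∑ i with 𝒜.output i = o, ‖𝒜.state f 𝒜.queries i‖ ^ 2

end Algorithm

/-- Quantum algorithms with vector outputs in the matrix-vector query model for `n × n` matrices
over `F`: a query to `A` is `|x, y⟩ ↦ |x, y + A x⟩` for `x, y ∈ Fⁿ`. -/
abbrev MVAlgorithm (F : Type*) [Fintype F] [DecidableEq F] (n : ℕ) : Type _ :=
  Algorithm (Fin n → F) (Fin n → F) (Fin n → F)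

/-- With query access to an arbitrary invertible `A`, the algorithm outputs the solution of
`A x = b` with probability at least `p`. The algorithm may depend on `b`. -/
def SolvesLinearSystem {F : Type*} [Field F] [Fintype F] [DecidableEq F] {n : ℕ}
    (𝒜 : MVAlgorithm F n) (b : Fin n → F) (p : ℝ) : Prop :=
  ∀ (A : Matrix (Fin n) (Fin n) F) (x : Fin n → F), IsUnit A → A *ᵥ x = b →
    p ≤ 𝒜.outputProb (fun v => A *ᵥ v) x

end QuantumQuery

namespace QuantumQuery

open Polynomial Module

/-! ### Averaging over two-sided orbits of the general linear group -/

section Counting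

variable {F V U : Type*} [Field F] [AddCommGroup V] [Module F V]
  [AddCommGroup U] [Module F U]

/-! This is the polynomial method with kernel dimension as the variable. Let `h f` be the
probability that the output `x` of a `t`-query algorithm satisfies `f x = b`. It is a combination of
indicators that prescribe `2t + 1` values of `f`: `2t` from squared amplitudes and one from the
check `f x = b`. Averaged over `G D C` with `G`, `C` invertible, it is a polynomial `P` of degree at
most `2t + 1` in `q ^ dim ker D` (`exists_polynomial_orbitSum`).

Including the check makes singular inputs useful: `h` vanishes unless `b` lies in the range, which
is rare when the kernel has dimension `j`, so the average at `q ^ j` is at most `2 ^ (-j)`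
(`norm_orbitSum_le`). At `1`, the invertible case, it is at least `p`. If `n ≥ J + 2t + 1`, there
are enough nodes `q ^ J, q ^ (J + 1), …` to determine `P`. Since they grow geometrically,
extrapolation to `1` has bounded weights (`norm_eval_one_le_of_geometric`) and gives at most `8 * 2
^ (-J)`, less than `p` for suitable `J`. -/

/-- Linear maps with the same kernel differ by an automorphism of the target. -/
theorem exists_linearEquiv_comp_eq_of_ker_eq [FiniteDimensional F V] {Z Y : U →ₗ[F] V}
    (h : LinearMap.ker Z = LinearMap.ker Y) :
    ∃ G : V ≃ₗ[F] V, (G : V →ₗ[F] V) ∘ₗ Z = Y := by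
  obtain ⟨g, hg⟩ := Submodule.exists_linearEquiv_restrict_eq
    (Z.quotKerEquivRange.symm ≪≫ₗ Submodule.quotEquivOfEq _ _ h ≪≫ₗ Y.quotKerEquivRange)
  refine ⟨g, LinearMap.ext fun u => ?_⟩
  have h1 := hg ⟨Z u, LinearMap.mem_range_self Z u⟩
  have h2 : Z.quotKerEquivRange.symm ⟨Z u, LinearMap.mem_range_self Z u⟩ =
      (LinearMap.ker Z).mkQ u := by
    rw [LinearEquiv.symm_apply_eq]
    rfl
  simp only [LinearEquiv.trans_apply, h2] at h1
  exact h1.symm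

/-- The number of ordered linearly independent `m`-tuples in a `d`-dimensional space over a field
with `q` elements, also when `d < m`. -/
theorem card_linearIndependent_eq [Fintype F] [Finite V] (m : ℕ) :
    (Nat.card {s : Fin m → V // LinearIndependent F s} : ℂ) =
      ∏ i : Fin m, ((Fintype.card F : ℂ) ^ finrank F V - (Fintype.card F : ℂ) ^ (i : ℕ)) := by
  have : FiniteDimensional F V := Module.Finite.of_finite
  by_cases hm : m ≤ finrank F V
  · rw [card_linearIndependent hm, Nat.cast_prod]
    refine Finset.prod_congr rfl fun i _ => ?_
    rw [Nat.cast_sub (Nat.pow_le_pow_right Fintype.card_pos (by omega))]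
    push_cast
    rfl
  · have : IsEmpty {s : Fin m → V // LinearIndependent F s} :=
      ⟨fun s => hm (by simpa using s.2.fintype_card_le_finrank)⟩
    rw [Nat.card_of_isEmpty, Nat.cast_zero, eq_comm]
    exact Finset.prod_eq_zero (Finset.mem_univ ⟨finrank F V, not_le.1 hm⟩) (by simp)

open Classical in
/-- The number of automorphisms mapping a fixed linearly independent tuple into a subspace. -/
theorem exists_card_maps_into_eq [Fintype F] [Finite V] [Fintype (V ≃ₗ[F] V)] {m : ℕ}
    {w : Fin m → V} (hw : LinearIndependent F w) :
    ∃ κ : ℂ, ∀ E : Submodule F V,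
      ∑ C : V ≃ₗ[F] V, (if ∀ i, C (w i) ∈ E then (1 : ℂ) else 0) =
        κ * ∏ i : Fin m, ((Fintype.card F : ℂ) ^ finrank F E - (Fintype.card F : ℂ) ^ (i : ℕ)) := by
  have : FiniteDimensional F V := Module.Finite.of_finite
  -- `κ` is the size of the stabiliser of `w`: every independent tuple in `E` is the image of `w`
  -- under exactly that many automorphisms.
  refine ⟨∑ C : V ≃ₗ[F] V, if ∀ i, C (w i) = w i then 1 else 0, fun E => ?_⟩
  rw [← card_linearIndependent_eq (F := F) (V := E) m]
  have : Fintype {s : Fin m → E // LinearIndependent F s} := Fintype.ofFinite _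
  have key : ∀ s : {s : Fin m → E // LinearIndependent F s},
      ∑ C : V ≃ₗ[F] V, (if ∀ i, C (w i) = s.1 i then (1 : ℂ) else 0) =
        ∑ C : V ≃ₗ[F] V, if ∀ i, C (w i) = w i then 1 else 0 := by
    intro s
    have hs : LinearIndependent F fun i => (s.1 i : V) :=
      s.2.map' E.subtype (Submodule.ker_subtype E)
    obtain ⟨G, hG⟩ := exists_linearEquiv_comp_eq_of_ker_eq
      (Z := Fintype.linearCombination F w) (Y := Fintype.linearCombination F fun i => (s.1 i : V))
      (by rw [LinearMap.ker_eq_bot.2 (linearIndependent_iff_injective_fintypeLinearCombination.1 hw),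
            LinearMap.ker_eq_bot.2 (linearIndependent_iff_injective_fintypeLinearCombination.1 hs)])
    have hG' : ∀ i, G (w i) = s.1 i := fun i => by
      simpa using LinearMap.congr_fun hG (Pi.single i 1)
    rw [← Equiv.sum_comp (Equiv.mulLeft G)]
    refine Finset.sum_congr rfl fun C _ => ?_
    simp only [Equiv.coe_mulLeft, LinearEquiv.mul_apply, ← hG', EmbeddingLike.apply_eq_iff_eq]
  have count : ∀ C : V ≃ₗ[F] V, (if ∀ i, C (w i) ∈ E then (1 : ℂ) else 0) =
      ∑ s : {s : Fin m → E // LinearIndependent F s},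
        if ∀ i, C (w i) = s.1 i then (1 : ℂ) else 0 := by
    intro C
    split_ifs with h
    · have hli : LinearIndependent F fun i => (⟨C (w i), h i⟩ : E) :=
        LinearIndependent.of_comp E.subtype
          (hw.map' (C : V →ₗ[F] V) (LinearEquiv.ker C))
      rw [Finset.sum_eq_single ⟨_, hli⟩ _ (fun h => absurd (Finset.mem_univ _) h)]
      · simp
      · intro s _ hs
        rw [if_neg]
        exact fun hC => hs (Subtype.ext (funext fun i => Subtype.ext (hC i).symm))
    · rw [Finset.sum_eq_zero]
      intro s _
      rw [if_neg]
      exact fun hC => h fun i => by rw [hC i]; exact (s.1 i).2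
  simp_rw [count]
  rw [Finset.sum_comm]
  simp_rw [key]
  simp [Nat.card_eq_fintype_card, mul_comm]

-- The condition says that `C` maps `Z(L)` into `ker D`. Testing it on a basis of `Z(L)` gives one
-- linear factor per basis vector.
open Classical in
theorem exists_polynomial_le_ker [Fintype F] [Finite V] [Fintype (V ≃ₗ[F] V)]
    [FiniteDimensional F U] (Z : U →ₗ[F] V) (L : Submodule F U) :
    ∃ P : ℂ[X], P.natDegree ≤ finrank F U ∧ ∀ D : V →ₗ[F] V,
      ∑ C : V ≃ₗ[F] V, (if L ≤ LinearMap.ker (D ∘ₗ (C : V →ₗ[F] V) ∘ₗ Z) then (1 : ℂ) else 0) =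
        P.eval ((Fintype.card F : ℂ) ^ finrank F (LinearMap.ker D)) := by
  have : FiniteDimensional F V := Module.Finite.of_finite
  let B := finBasis F (L.map Z)
  have hB : LinearIndependent F fun i => (B i : V) :=
    B.linearIndependent.map' (L.map Z).subtype (Submodule.ker_subtype _)
  obtain ⟨κ, hκ⟩ := exists_card_maps_into_eq hB
  refine ⟨Polynomial.C κ * ∏ i : Fin (finrank F (L.map Z)),
    (X - Polynomial.C ((Fintype.card F : ℂ) ^ (i : ℕ))), ?_, fun D => ?_⟩
  · refine (natDegree_C_mul_le _ _).trans ?_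
    rw [natDegree_prod_of_monic _ _ fun i _ => monic_X_sub_C _]
    simp only [natDegree_X_sub_C, Finset.sum_const, Finset.card_univ, Fintype.card_fin,
      smul_eq_mul, mul_one]
    exact (Submodule.finrank_map_le Z L).trans (Submodule.finrank_le L)
  · have := hκ (LinearMap.ker D)
    simp only [eval_mul, eval_C, eval_prod, eval_sub, eval_X]
    rw [← this]
    refine Finset.sum_congr rfl fun C _ => if_congr ?_ rfl rfl
    have hspan : L.map Z = Submodule.span F (Set.range fun i => (B i : V)) := by
      have := congrArg (Submodule.map (L.map Z).subtype) B.span_eq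
      rw [Submodule.map_span, Submodule.map_subtype_top, ← Set.range_comp] at this
      exact this.symm
    rw [LinearMap.ker_comp, Submodule.comap_comp, ← Submodule.map_le_iff_le_comap]
    refine (iff_of_eq (congrArg (· ≤ _) hspan)).trans ?_
    rw [Submodule.span_le, Set.range_subset_iff]
    rfl

-- Inclusion–exclusion on the subspace lattice, from larger `L` downwards: subtract from the count
-- for `L ≤ ker` the counts for each strictly larger kernel.
open Classical in
theorem exists_polynomial_ker_eq [Fintype F] [Finite V] [Fintype (V ≃ₗ[F] V)]
    [FiniteDimensional F U] [Finite U] (Z : U →ₗ[F] V) (L : Submodule F U) :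
    ∃ P : ℂ[X], P.natDegree ≤ finrank F U ∧ ∀ D : V →ₗ[F] V,
      ∑ C : V ≃ₗ[F] V, (if LinearMap.ker (D ∘ₗ (C : V →ₗ[F] V) ∘ₗ Z) = L then (1 : ℂ) else 0) =
        P.eval ((Fintype.card F : ℂ) ^ finrank F (LinearMap.ker D)) := by
  have : Fintype (Submodule F U) := Fintype.ofFinite _
  induction L using WellFoundedGT.induction with
  | ind L ih =>
    obtain ⟨P, hP, hPe⟩ := exists_polynomial_le_ker Z L
    choose! Q hQ hQe using ih
    refine ⟨P - ∑ M : Submodule F U with L < M, Q M, ?_, fun D => ?_⟩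
    · refine (natDegree_sub_le _ _).trans (max_le hP ?_)
      exact natDegree_sum_le_of_forall_le _ _ fun M hM => hQ M (Finset.mem_filter.1 hM).2
    · rw [eval_sub, eval_finsetSum, ← hPe, Finset.sum_congr rfl fun M hM =>
        (hQe M (Finset.mem_filter.1 hM).2 D).symm, Finset.sum_comm, ← Finset.sum_sub_distrib]
      refine Finset.sum_congr rfl fun C _ => ?_
      rw [Finset.sum_ite_eq]
      rcases eq_or_ne (LinearMap.ker (D ∘ₗ (C : V →ₗ[F] V) ∘ₗ Z)) L with h | h
      · simp [h]
      · have := le_iff_eq_or_lt (a := L) (b := LinearMap.ker (D ∘ₗ (C : V →ₗ[F] V) ∘ₗ Z))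
        by_cases h' : L < LinearMap.ker (D ∘ₗ (C : V →ₗ[F] V) ∘ₗ Z)
        · simp [h, h', h'.le]
        · have h'' : ¬ L ≤ LinearMap.ker (D ∘ₗ (C : V →ₗ[F] V) ∘ₗ Z) := by
            rw [this]; tauto
          simp [h, h', h'']

/-- The sum of `h` over all products `G D C` with `G` and `C` invertible. -/
noncomputable def orbitSum [Fintype (V ≃ₗ[F] V)] (D : V →ₗ[F] V) (h : (V → V) → ℂ) : ℂ :=
  ∑ G : V ≃ₗ[F] V, ∑ C : V ≃ₗ[F] V, h fun v => G (D (C v))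

-- With `x`, `y` encoded as maps `Z`, `Y` from `F ^ k`, the event is `G D C Z = Y`. For fixed `C` it
-- is solvable in `G` exactly when `ker (D C Z) = ker Y`, and the number of solutions is then the
-- size of the stabiliser of `Y`.
open Classical in
theorem exists_polynomial_orbitSum_indicator [Fintype F] [Finite V] [Fintype (V ≃ₗ[F] V)] {k : ℕ}
    (x y : Fin k → V) :
    ∃ P : ℂ[X], P.natDegree ≤ k ∧ ∀ D : V →ₗ[F] V,
      orbitSum D (fun f => if ∀ l, f (x l) = y l then 1 else 0) =
        P.eval ((Fintype.card F : ℂ) ^ finrank F (LinearMap.ker D)) := by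
  have : FiniteDimensional F V := Module.Finite.of_finite
  let Z : (Fin k → F) →ₗ[F] V := Fintype.linearCombination F x
  let Y : (Fin k → F) →ₗ[F] V := Fintype.linearCombination F y
  obtain ⟨P, hP, hPe⟩ := exists_polynomial_ker_eq Z (LinearMap.ker Y)
  let κ : ℂ := ∑ G : V ≃ₗ[F] V, if (G : V →ₗ[F] V) ∘ₗ Y = Y then 1 else 0
  refine ⟨Polynomial.C κ * P, (natDegree_C_mul_le _ _).trans (by simpa using hP), fun D => ?_⟩
  rw [eval_mul, eval_C, ← hPe, Finset.mul_sum, orbitSum, Finset.sum_comm]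
  refine Finset.sum_congr rfl fun C _ => ?_
  set W : (Fin k → F) →ₗ[F] V := D ∘ₗ (C : V →ₗ[F] V) ∘ₗ Z with hW
  have hiff : ∀ G : V ≃ₗ[F] V, (∀ l, G (D (C (x l))) = y l) ↔ (G : V →ₗ[F] V) ∘ₗ W = Y := by
    intro G
    constructor
    · intro h
      refine LinearMap.pi_ext' fun l => LinearMap.ext_ring ?_
      simpa [hW, Z, Y] using h l
    · intro h l
      simpa [hW, Z, Y] using LinearMap.congr_fun h (Pi.single l 1)
  simp_rw [hiff]
  split_ifs with h
  · obtain ⟨G₀, hG₀⟩ := exists_linearEquiv_comp_eq_of_ker_eq h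
    rw [mul_one, ← Equiv.sum_comp (Equiv.mulRight G₀)]
    refine Finset.sum_congr rfl fun G _ => if_congr ?_ rfl rfl
    rw [← hG₀]
    rfl
  · rw [mul_zero]
    refine Finset.sum_eq_zero fun G _ => if_neg fun hG => h ?_
    rw [← hG, LinearEquiv.ker_comp]

end Counting

end QuantumQuery

/-! ### Extrapolation from geometric nodes -/

namespace QuantumQuery

open Polynomial

theorem quarter_le_prod_one_sub_half_pow (e : ℕ) :
    (1 / 4 : ℝ) ≤ ∏ k ∈ Finset.range e, (1 - (1 / 2 : ℝ) ^ (k + 1)) := by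
  -- The bare bound `1 / 4` is not inductive; the extra term absorbs the loss from the next factor.
  have key : ∀ e : ℕ, (1 / 4 : ℝ) + (1 / 2) ^ (e + 1) / 2 ≤
      ∏ k ∈ Finset.range (e + 1), (1 - (1 / 2 : ℝ) ^ (k + 1)) := by
    intro e
    induction e with
    | zero => norm_num
    | succ e ih =>
      rw [Finset.prod_range_succ]
      have h0 : (0 : ℝ) ≤ (1 / 2) ^ e := by positivity
      have h1 : (1 / 2 : ℝ) ^ e ≤ 1 := pow_le_one₀ (by norm_num) (by norm_num)
      have h2 : (0 : ℝ) ≤ 1 - (1 / 2) ^ (e + 1 + 1) := by rw [pow_succ, pow_succ]; linarith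
      refine le_trans ?_ (mul_le_mul_of_nonneg_right ih h2)
      simp only [pow_succ]
      nlinarith
  cases e with
  | zero => norm_num
  | succ e =>
    have h := key e
    have : (0 : ℝ) ≤ (1 / 2) ^ (e + 1) := by positivity
    linarith

/-- The weights for extrapolating from the nodes `q ^ J, …, q ^ (J + d)` to `1` are bounded. -/
theorem norm_eval_one_basis_geometric_le {q : ℕ} (hq : 2 ≤ q) (J d j : ℕ) (hj : j ≤ d) :
    ‖(Lagrange.basis (Finset.range (d + 1)) (fun i => (q : ℂ) ^ (J + i)) j).eval 1‖ ≤ 4 := by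
  have hq' : (2 : ℝ) ≤ q := by exact_mod_cast hq
  have hq0 : (0 : ℝ) < q := by linarith
  -- Bounds for the factors `(q ^ (J + i) - 1) / |q ^ (J + j) - q ^ (J + i)|`: nodes below `j`
  -- contribute at most `1`, those above form a convergent product.
  let a : ℕ → ℝ := fun i => if i ≤ j then 1 else (1 - (1 / 2 : ℝ) ^ (i - j))⁻¹
  have hpow : ∀ e : ℕ, (1 / 2 : ℝ) ^ (e + 1) ≤ 1 / 2 := fun e => by
    rw [pow_succ]
    nlinarith [pow_le_one₀ (n := e) (a := (1 / 2 : ℝ)) (by norm_num) (by norm_num)]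
  have hfac : ∀ i, i ≠ j →
      ‖(Lagrange.basisDivisor ((q : ℂ) ^ (J + j)) ((q : ℂ) ^ (J + i))).eval 1‖ ≤ a i := by
    intro i hij
    have e1 : (Lagrange.basisDivisor ((q : ℂ) ^ (J + j)) ((q : ℂ) ^ (J + i))).eval 1 =
        (((((q : ℝ) ^ (J + j) - (q : ℝ) ^ (J + i))⁻¹ * (1 - (q : ℝ) ^ (J + i)) : ℝ)) : ℂ) := by
      simp [Lagrange.basisDivisor]
    rw [e1, Complex.norm_real, norm_mul, norm_inv, Real.norm_eq_abs, Real.norm_eq_abs,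
      ← div_eq_inv_mul]
    have hP : (1 : ℝ) ≤ (q : ℝ) ^ (J + i) := one_le_pow₀ (by linarith)
    have hP' : (1 : ℝ) ≤ (q : ℝ) ^ (J + j) := one_le_pow₀ (by linarith)
    rw [abs_of_nonpos (a := 1 - (q : ℝ) ^ (J + i)) (by linarith)]
    simp only [a]
    rcases lt_or_gt_of_ne hij with h | h
    · rw [if_pos h.le]
      obtain ⟨e, rfl⟩ := Nat.exists_eq_add_of_lt h
      have h2 : 2 * (q : ℝ) ^ (J + i) ≤ (q : ℝ) ^ (J + (i + e + 1)) := by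
        rw [show J + (i + e + 1) = e + 1 + (J + i) by ring, pow_add (q : ℝ) (e + 1)]
        refine mul_le_mul_of_nonneg_right ?_ (zero_le_one.trans hP)
        rw [pow_succ]
        have : (1 : ℝ) ≤ (q : ℝ) ^ e := one_le_pow₀ (by linarith)
        nlinarith
      rw [abs_of_nonneg (by linarith)]
      exact div_le_one_of_le₀ (by linarith) (by linarith)
    · rw [if_neg (by omega)]
      obtain ⟨e, rfl⟩ := Nat.exists_eq_add_of_lt h
      rw [show j + e + 1 - j = e + 1 by omega]
      have h2 : (q : ℝ) ^ (J + j) ≤ (1 / 2) ^ (e + 1) * (q : ℝ) ^ (J + (j + e + 1)) := by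
        rw [show J + (j + e + 1) = e + 1 + (J + j) by ring, pow_add (q : ℝ) (e + 1), ← mul_assoc,
          ← mul_pow]
        exact le_mul_of_one_le_left (by positivity) (one_le_pow₀ (by linarith))
      have h3 := hpow e
      have h4 : 0 < (1 - (1 / 2 : ℝ) ^ (e + 1)) * (q : ℝ) ^ (J + (j + e + 1)) := by
        apply mul_pos <;> linarith
      rw [abs_of_nonpos (by linarith), ← one_div, div_le_div_iff₀ (by linarith) (by linarith)]
      nlinarith
  have ha : ∀ i, 1 ≤ a i := fun i => by
    simp only [a]
    split_ifs with h
    · exact le_rfl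
    · obtain ⟨e, rfl⟩ := Nat.exists_eq_add_of_lt (not_le.1 h)
      rw [show j + e + 1 - j = e + 1 by omega]
      have h3 := hpow e
      have : (0 : ℝ) ≤ (1 / 2) ^ (e + 1) := by positivity
      exact (one_le_inv₀ (by linarith)).2 (by linarith)
  rw [Lagrange.basis, eval_prod, norm_prod]
  calc _ ≤ ∏ i ∈ (Finset.range (d + 1)).erase j, a i :=
        Finset.prod_le_prod (fun _ _ => norm_nonneg _)
          fun i hi => hfac i (Finset.ne_of_mem_erase hi)
    _ ≤ ∏ i ∈ Finset.range (d + 1), a i :=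
        Finset.prod_le_prod_of_subset_of_one_le (Finset.erase_subset _ _)
          (fun i _ => zero_le_one.trans (ha i)) fun i _ _ => ha i
    _ = (∏ k ∈ Finset.range (d - j), (1 - (1 / 2 : ℝ) ^ (k + 1)))⁻¹ := by
        rw [show d + 1 = (j + 1) + (d - j) by omega, Finset.prod_range_add, ← Finset.prod_inv_distrib,
          Finset.prod_eq_one, one_mul]
        · refine Finset.prod_congr rfl fun k _ => ?_
          simp only [a]
          rw [if_neg (by omega), show j + 1 + k - j = k + 1 by omega]
        · intro i hi
          exact if_pos (Nat.lt_succ_iff.1 (Finset.mem_range.1 hi))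
    _ ≤ 4 := by
        have := quarter_le_prod_one_sub_half_pow (d - j)
        exact inv_le_of_inv_le₀ (by norm_num) (by linarith)

/-- A polynomial of degree at most `d` that is small at `q ^ J, …, q ^ (J + d)` is small at `1`. -/
theorem norm_eval_one_le_of_geometric {q : ℕ} (hq : 2 ≤ q) {J d : ℕ} {P : ℂ[X]}
    (hP : P.natDegree ≤ d) {M : ℝ}
    (h : ∀ j, J ≤ j → j ≤ J + d → ‖P.eval ((q : ℂ) ^ j)‖ ≤ M * (1 / 2) ^ j) :
    ‖P.eval 1‖ ≤ 8 * M * (1 / 2) ^ J := by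
  have hM : 0 ≤ M := by
    have := (norm_nonneg _).trans (h J le_rfl (by omega))
    exact nonneg_of_mul_nonneg_left this (by positivity)
  have hinj : Set.InjOn (fun i => (q : ℂ) ^ (J + i)) (Finset.range (d + 1) : Set ℕ) := by
    intro i _ j _ hij
    have : q ^ (J + i) = q ^ (J + j) := by
      simp only at hij
      exact_mod_cast hij
    have := Nat.pow_right_injective hq this
    omega
  have hdeg : P.degree < (Finset.range (d + 1)).card := by
    rw [Finset.card_range]
    exact (degree_le_of_natDegree_le hP).trans_lt (by exact_mod_cast Nat.lt_succ_self d)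
  rw [Lagrange.eq_interpolate hinj hdeg, Lagrange.interpolate_apply, eval_finsetSum]
  calc _ ≤ ∑ i ∈ Finset.range (d + 1), 4 * M * (1 / 2) ^ J * (1 / 2) ^ i := by
        refine norm_sum_le_of_le _ fun i hi => ?_
        have hi' := Nat.lt_succ_iff.1 (Finset.mem_range.1 hi)
        rw [eval_mul, eval_C, norm_mul]
        have h1 := h (J + i) (by omega) (by omega)
        have h2 := norm_eval_one_basis_geometric_le hq J d i hi'
        calc _ ≤ M * (1 / 2) ^ (J + i) * 4 :=
              mul_le_mul h1 h2 (norm_nonneg _) (by positivity)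
          _ = _ := by rw [pow_add]; ring
    _ = 4 * M * (1 / 2) ^ J * ∑ i ∈ Finset.range (d + 1), (1 / 2 : ℝ) ^ i := by
        rw [Finset.mul_sum]
    _ ≤ 4 * M * (1 / 2) ^ J * 2 :=
        mul_le_mul_of_nonneg_left (sum_geometric_two_le _) (by positivity)
    _ = _ := by ring

end QuantumQuery

/-! ### Acceptance probabilities as combinations of query indicators -/

namespace QuantumQuery

section QuerySpan

variable {X G : Type*}

open Classical in
/-- Functions of `f : X → G` that are combinations of indicators of `k` values of `f`. -/
noncomputable def querySpan (X G : Type*) (k : ℕ) : Submodule ℂ ((X → G) → ℂ) :=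
  Submodule.span ℂ (Set.range fun xy : (Fin k → X) × (Fin k → G) =>
    fun f => if ∀ l, f (xy.1 l) = xy.2 l then 1 else 0)

theorem const_mem_querySpan (c : ℂ) : (fun _ => c) ∈ querySpan X G 0 := by
  have h : (fun _ => (1 : ℂ)) ∈ querySpan X G 0 :=
    Submodule.subset_span ⟨(Fin.elim0, Fin.elim0), by ext f; simp⟩
  simpa [Pi.smul_def] using Submodule.smul_mem _ c h

theorem indicator_mem_querySpan [DecidableEq G] (x : X) (y : G) :
    (fun f : X → G => if f x = y then (1 : ℂ) else 0) ∈ querySpan X G 1 :=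
  Submodule.subset_span ⟨(fun _ => x, fun _ => y), by ext f; simp⟩

/-- Concatenate the two lists of constraints; repeated or contradictory constraints are allowed. -/
theorem mul_mem_querySpan {a b : ℕ} {g h : (X → G) → ℂ} (hg : g ∈ querySpan X G a)
    (hh : h ∈ querySpan X G b) : (fun f => g f * h f) ∈ querySpan X G (a + b) := by
  have hle : querySpan X G a * querySpan X G b ≤ querySpan X G (a + b) := by
    rw [querySpan, querySpan, Submodule.span_mul_span, Submodule.span_le]
    rintro _ ⟨_, ⟨u, rfl⟩, _, ⟨v, rfl⟩, rfl⟩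
    refine Submodule.subset_span ⟨(Fin.append u.1 v.1, Fin.append u.2 v.2), ?_⟩
    ext f
    have h : (∀ l, f (Fin.append u.1 v.1 l) = Fin.append u.2 v.2 l) ↔
        (∀ l, f (u.1 l) = u.2 l) ∧ ∀ l, f (v.1 l) = v.2 l := by
      simp only [Fin.forall_fin_add, Fin.append_left, Fin.append_right]
    by_cases h1 : ∀ l, f (u.1 l) = u.2 l <;> by_cases h2 : ∀ l, f (v.1 l) = v.2 l <;>
      simp only [Pi.mul_apply, h, h1, h2, and_self, and_false, false_and, implies_true, if_true,
        if_false, mul_one, mul_zero]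
  exact hle (Submodule.mul_mem_mul hg hh)

theorem star_mem_querySpan {a : ℕ} {g : (X → G) → ℂ} (hg : g ∈ querySpan X G a) :
    (fun f => star (g f)) ∈ querySpan X G a := by
  induction hg using Submodule.span_induction with
  | mem g hg =>
    obtain ⟨u, rfl⟩ := hg
    refine Submodule.subset_span ⟨u, ?_⟩
    ext f
    simp only []
    split_ifs <;> simp
  | zero =>
    convert (querySpan X G a).zero_mem using 1
    ext f
    simp
  | add g h _ _ hg hh =>
    convert (querySpan X G a).add_mem hg hh using 1
    ext f
    simp
  | smul c g _ hg =>
    convert (querySpan X G a).smul_mem (star c) hg using 1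
    ext f
    simp

theorem sum_mem_querySpan {ι : Type*} {a : ℕ} (s : Finset ι) {g : ι → (X → G) → ℂ}
    (hg : ∀ i ∈ s, g i ∈ querySpan X G a) : (fun f => ∑ i ∈ s, g i f) ∈ querySpan X G a := by
  have := Submodule.sum_mem _ hg
  convert this using 1
  ext f
  simp

end QuerySpan

section Unitary

variable {ι : Type*} [Fintype ι] [DecidableEq ι]

theorem sum_norm_sq_unitary_mulVec (U : Matrix.unitaryGroup ι ℂ) (v : ι → ℂ) :
    ∑ i, ‖((U : Matrix ι ι ℂ) *ᵥ v) i‖ ^ 2 = ∑ i, ‖v i‖ ^ 2 := by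
  have key : ∀ w : ι → ℂ, ((∑ i, ‖w i‖ ^ 2 : ℝ) : ℂ) = star w ⬝ᵥ w := by
    intro w
    rw [dotProduct, Complex.ofReal_sum]
    refine Finset.sum_congr rfl fun i _ => ?_
    simpa using (Complex.conj_mul' (w i)).symm
  apply Complex.ofReal_injective
  rw [key, key, Matrix.star_mulVec, Matrix.dotProduct_mulVec, Matrix.vecMul_vecMul,
    ← Matrix.star_eq_conjTranspose, Matrix.UnitaryGroup.star_mul_self, Matrix.vecMul_one]

end Unitary

section Oracle

variable {X G Ω : Type*} [Fintype X] [DecidableEq X] [Fintype G] [DecidableEq G] [AddGroup G]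

theorem oracle_mulVec_apply {k : ℕ} (f : X → G) (v : BasisLabel X G k → ℂ)
    (i : BasisLabel X G k) :
    (oracle f *ᵥ v) i = v (i.1, i.2.1 - f i.1, i.2.2) := by
  rw [Matrix.mulVec, dotProduct, Finset.sum_eq_single (i.1, i.2.1 - f i.1, i.2.2)]
  · simp [oracle]
  · rintro ⟨x, y, w⟩ _ h
    rw [oracle, if_neg, zero_mul]
    rintro rfl
    simp at h
  · simp

theorem sum_norm_sq_oracle_mulVec {k : ℕ} (f : X → G) (v : BasisLabel X G k → ℂ) :
    ∑ i, ‖(oracle f *ᵥ v) i‖ ^ 2 = ∑ i, ‖v i‖ ^ 2 := by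
  simp_rw [oracle_mulVec_apply]
  let e : BasisLabel X G k ≃ BasisLabel X G k :=
    { toFun := fun i => (i.1, i.2.1 - f i.1, i.2.2)
      invFun := fun i => (i.1, i.2.1 + f i.1, i.2.2)
      left_inv := fun i => by simp
      right_inv := fun i => by simp }
  exact Equiv.sum_comp e fun i => ‖v i‖ ^ 2

namespace Algorithm

theorem sum_norm_sq_state (𝒜 : Algorithm X G Ω) (f : X → G) (s : ℕ) :
    ∑ i, ‖𝒜.state f s i‖ ^ 2 = 1 := by
  induction s with
  | zero =>
    rw [state, sum_norm_sq_unitary_mulVec, Finset.sum_eq_single 𝒜.start]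
    · simp
    · intro i _ hi
      simp [hi]
    · simp
  | succ s ih => rw [state, sum_norm_sq_unitary_mulVec, sum_norm_sq_oracle_mulVec, ih]

theorem outputProb_nonneg [DecidableEq Ω] (𝒜 : Algorithm X G Ω) (f : X → G) (o : Ω) :
    0 ≤ 𝒜.outputProb f o :=
  Finset.sum_nonneg fun _ _ => sq_nonneg _

theorem sum_outputProb [Fintype Ω] [DecidableEq Ω] (𝒜 : Algorithm X G Ω) (f : X → G) :
    ∑ o, 𝒜.outputProb f o = 1 := by
  rw [← 𝒜.sum_norm_sq_state f 𝒜.queries]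
  exact Finset.sum_fiberwise _ _ _

theorem state_mem_querySpan (𝒜 : Algorithm X G Ω) (s : ℕ) (i : BasisLabel X G 𝒜.workDim) :
    (fun f => 𝒜.state f s i) ∈ querySpan X G s := by
  induction s generalizing i with
  | zero => exact const_mem_querySpan _
  | succ s ih =>
    simp only [state, Matrix.mulVec, dotProduct]
    refine sum_mem_querySpan _ fun j _ => Submodule.smul_mem _ _ ?_
    change (fun f => (oracle f *ᵥ 𝒜.state f s) j) ∈ _
    -- Splitting by the queried value `y` costs exactly one new indicator.
    have h : (fun f => (oracle f *ᵥ 𝒜.state f s) j) = fun f =>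
        ∑ y, 𝒜.state f s (j.1, j.2.1 - y, j.2.2) * if f j.1 = y then 1 else 0 := by
      ext f
      rw [oracle_mulVec_apply]
      simp
    rw [h]
    exact sum_mem_querySpan _ fun y _ => mul_mem_querySpan (ih _) (indicator_mem_querySpan _ _)

theorem outputProb_mem_querySpan [DecidableEq Ω] (𝒜 : Algorithm X G Ω) (o : Ω) :
    (fun f => (𝒜.outputProb f o : ℂ)) ∈ querySpan X G (𝒜.queries + 𝒜.queries) := by
  have h : (fun f => (𝒜.outputProb f o : ℂ)) = fun f => ∑ i with 𝒜.output i = o,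
      star (𝒜.state f 𝒜.queries i) * 𝒜.state f 𝒜.queries i := by
    ext f
    rw [outputProb, Complex.ofReal_sum]
    refine Finset.sum_congr rfl fun i _ => ?_
    simpa using (Complex.conj_mul' _).symm
  rw [h]
  exact sum_mem_querySpan _ fun i _ => mul_mem_querySpan
    (star_mem_querySpan (𝒜.state_mem_querySpan _ i)) (𝒜.state_mem_querySpan _ i)

end Algorithm

end Oracle

/-! ### The lower bound for linear systems -/

section LinearSystem

open Polynomial Module

theorem exists_polynomial_orbitSum {F V : Type*} [Field F] [AddCommGroup V] [Module F V]
    [Fintype F] [Finite V] [Fintype (V ≃ₗ[F] V)] {k : ℕ} {h : (V → V) → ℂ}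
    (hh : h ∈ querySpan V V k) :
    ∃ P : ℂ[X], P.natDegree ≤ k ∧ ∀ D : V →ₗ[F] V,
      orbitSum D h = P.eval ((Fintype.card F : ℂ) ^ finrank F (LinearMap.ker D)) := by
  induction hh using Submodule.span_induction with
  | mem g hg =>
    obtain ⟨u, rfl⟩ := hg
    exact exists_polynomial_orbitSum_indicator u.1 u.2
  | zero => exact ⟨0, by simp, fun D => by simp [orbitSum]⟩
  | add g h _ _ hg hh =>
    obtain ⟨P, hP, hPe⟩ := hg
    obtain ⟨Q, hQ, hQe⟩ := hh
    refine ⟨P + Q, (natDegree_add_le _ _).trans (max_le hP hQ), fun D => ?_⟩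
    rw [eval_add, ← hPe, ← hQe]
    simp [orbitSum, Finset.sum_add_distrib]
  | smul c g _ hg =>
    obtain ⟨P, hP, hPe⟩ := hg
    refine ⟨c • P, (natDegree_smul_le _ _).trans hP, fun D => ?_⟩
    rw [eval_smul, ← hPe]
    simp [orbitSum, Finset.mul_sum]

/-- A product `G D C` with `G` and `C` random hits a fixed nonzero vector with probability at most
`q ^ (-dim ker D)`. -/
theorem norm_orbitSum_le {F V : Type*} [Field F] [AddCommGroup V] [Module F V]
    [Fintype F] [Finite V] [Fintype (V ≃ₗ[F] V)] {h : (V → V) → ℂ} {b : V} (hb : b ≠ 0)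
    (h_le : ∀ f, ‖h f‖ ≤ 1) (h_zero : ∀ f, (∀ v, f v ≠ b) → h f = 0) (D : V →ₗ[F] V) :
    ‖orbitSum D h‖ ≤
      (Fintype.card (V ≃ₗ[F] V) : ℝ) ^ 2 * (1 / 2) ^ finrank F (LinearMap.ker D) := by
  classical
  have : FiniteDimensional F V := Module.Finite.of_finite
  obtain ⟨κ, hκ⟩ := exists_card_maps_into_eq (F := F) (w := fun _ : Fin 1 => b)
    (LinearIndependent.of_subsingleton 0 hb)
  have hq : (2 : ℝ) ≤ Fintype.card F := by exact_mod_cast Fintype.one_lt_card (α := F)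
  have h1 : (Fintype.card (V ≃ₗ[F] V) : ℝ) = ‖κ‖ * ((Fintype.card F : ℝ) ^ finrank F V - 1) := by
    have := congrArg norm (hκ ⊤)
    simp only [Submodule.mem_top, implies_true, if_true, Finset.sum_const, Finset.card_univ,
      nsmul_eq_mul, mul_one, Complex.norm_natCast, finrank_top, Finset.univ_unique,
      Finset.prod_singleton, Fin.default_eq_zero, Fin.val_zero, pow_zero, norm_mul] at this
    rw [this]
    congr 1
    have e : ((Fintype.card F : ℂ) ^ finrank F V - 1) =
      (((Fintype.card F : ℝ) ^ finrank F V - 1 : ℝ) : ℂ) := by push_cast; rfl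
    rw [e, Complex.norm_real, Real.norm_of_nonneg]
    exact sub_nonneg.2 (one_le_pow₀ (by linarith))
  have h2 : ∑ G : V ≃ₗ[F] V, (if G b ∈ LinearMap.range D then (1 : ℝ) else 0) =
      ‖κ‖ * ((Fintype.card F : ℝ) ^ finrank F (LinearMap.range D) - 1) := by
    have := congrArg norm (hκ (LinearMap.range D))
    simp only [forall_const, Finset.univ_unique,
      Finset.prod_singleton, Fin.default_eq_zero, Fin.val_zero, pow_zero, norm_mul] at this
    have e : ((Fintype.card F : ℂ) ^ finrank F (LinearMap.range D) - 1) =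
      (((Fintype.card F : ℝ) ^ finrank F (LinearMap.range D) - 1 : ℝ) : ℂ) := by push_cast; rfl
    have e' : ∑ G : V ≃ₗ[F] V, (if G b ∈ LinearMap.range D then (1 : ℂ) else 0) =
      ((∑ G : V ≃ₗ[F] V, (if G b ∈ LinearMap.range D then (1 : ℝ) else 0) : ℝ) : ℂ) := by
      rw [Complex.ofReal_sum]
      exact Finset.sum_congr rfl fun G _ => by split_ifs <;> simp
    rw [e, e', Complex.norm_real, Complex.norm_real, Real.norm_of_nonneg, Real.norm_of_nonneg]
      at this
    · exact this
    · exact sub_nonneg.2 (one_le_pow₀ (by linarith))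
    · exact Finset.sum_nonneg fun G _ => by split_ifs <;> norm_num
  -- `G D C` attains `b` only if `G⁻¹ b` lies in the range of `D`, whatever `C` is.
  have h3 : ‖orbitSum D h‖ ≤ ∑ G : V ≃ₗ[F] V, ∑ C : V ≃ₗ[F] V,
      (if G⁻¹ b ∈ LinearMap.range D then (1 : ℝ) else 0) := by
    refine norm_sum_le_of_le _ fun G _ => norm_sum_le_of_le _ fun C _ => ?_
    split_ifs with hG
    · exact h_le _
    · rw [h_zero, norm_zero]
      rintro v rfl
      exact hG ⟨C v, (G.symm_apply_apply _).symm⟩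
  simp only [Finset.sum_const, Finset.card_univ, nsmul_eq_mul, ← Finset.mul_sum] at h3
  have h4 := Equiv.sum_comp (Equiv.inv (V ≃ₗ[F] V))
    (fun G => if G b ∈ LinearMap.range D then (1 : ℝ) else 0)
  simp only [Equiv.inv_apply] at h4
  rw [h4, h2] at h3
  refine h3.trans ?_
  rw [sq, mul_assoc]
  refine mul_le_mul_of_nonneg_left ?_ (Nat.cast_nonneg _)
  rw [h1, mul_assoc]
  refine mul_le_mul_of_nonneg_left ?_ (norm_nonneg _)
  rw [← LinearMap.finrank_range_add_finrank_ker D, pow_add]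
  generalize finrank F (LinearMap.range D) = r
  generalize finrank F (LinearMap.ker D) = j
  generalize (Fintype.card F : ℝ) = q at hq
  have ha : (1 : ℝ) ≤ q ^ j * (1 / 2) ^ j := by
    rw [← mul_pow]
    exact one_le_pow₀ (by linarith)
  have hc : (1 / 2 : ℝ) ^ j ≤ 1 := pow_le_one₀ (by norm_num) (by norm_num)
  have hr : (0 : ℝ) ≤ q ^ r := by positivity
  nlinarith

theorem exists_linearMap_finrank_ker_eq (F : Type*) [Field F] {n j : ℕ} (hj : j ≤ n) :
    ∃ D : (Fin n → F) →ₗ[F] (Fin n → F), finrank F (LinearMap.ker D) = j := by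
  classical
  let w : Fin n → F := fun i => if (i : ℕ) < j then 0 else 1
  refine ⟨(Matrix.diagonal w).mulVecLin, ?_⟩
  have h1 := LinearMap.finrank_range_add_finrank_ker (Matrix.diagonal w).mulVecLin
  have h2 : finrank F (LinearMap.range (Matrix.diagonal w).mulVecLin) = n - j := by
    change (Matrix.diagonal w).rank = _
    have hc : Fintype.card {i : Fin n // (i : ℕ) < j} = j := by
      rw [Fintype.card_subtype]
      simpa [hj] using Fin.card_filter_val_lt (n := n) (m := j)
    rw [Matrix.rank_diagonal, ← hc]
    simp only [w, ne_eq, ite_eq_left_iff, one_ne_zero, imp_false, not_not]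
    rw [Fintype.card_subtype_compl]
    simp
  rw [h2, finrank_fin_fun] at h1
  omega

variable {F : Type*} [Field F] [Fintype F] [DecidableEq F] {n : ℕ}

/-- The probability that the output solves `f x = b`. -/
noncomputable def solveProb (𝒜 : MVAlgorithm F n) (b : Fin n → F)
    (f : (Fin n → F) → (Fin n → F)) : ℝ :=
  ∑ x, 𝒜.outputProb f x * if f x = b then 1 else 0

theorem outputProb_le_solveProb (𝒜 : MVAlgorithm F n) {f : (Fin n → F) → (Fin n → F)}
    {b x : Fin n → F} (hx : f x = b) : 𝒜.outputProb f x ≤ solveProb 𝒜 b f := by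
  have := Finset.single_le_sum (f := fun x => 𝒜.outputProb f x * if f x = b then (1 : ℝ) else 0)
    (fun x _ => mul_nonneg (𝒜.outputProb_nonneg f x) (by split_ifs <;> norm_num))
    (Finset.mem_univ x)
  simpa [hx, solveProb] using this

theorem solveProb_nonneg (𝒜 : MVAlgorithm F n) (b : Fin n → F) (f : (Fin n → F) → (Fin n → F)) :
    0 ≤ solveProb 𝒜 b f :=
  Finset.sum_nonneg fun x _ => mul_nonneg (𝒜.outputProb_nonneg f x) (by split_ifs <;> norm_num)

theorem solveProb_le_one (𝒜 : MVAlgorithm F n) (b : Fin n → F) (f : (Fin n → F) → (Fin n → F)) :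
    solveProb 𝒜 b f ≤ 1 := by
  rw [← 𝒜.sum_outputProb f]
  refine Finset.sum_le_sum fun x _ => mul_le_of_le_one_right (𝒜.outputProb_nonneg f x) ?_
  split_ifs <;> norm_num

theorem solveProb_mem_querySpan (𝒜 : MVAlgorithm F n) (b : Fin n → F) :
    (fun f => (solveProb 𝒜 b f : ℂ)) ∈
      querySpan (Fin n → F) (Fin n → F) (𝒜.queries + 𝒜.queries + 1) := by
  have h : (fun f => (solveProb 𝒜 b f : ℂ)) = fun f =>
      ∑ x, (𝒜.outputProb f x : ℂ) * if f x = b then 1 else 0 := by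
    ext f
    simp only [solveProb, Complex.ofReal_sum, Complex.ofReal_mul]
    exact Finset.sum_congr rfl fun x _ => by split_ifs <;> simp
  rw [h]
  exact sum_mem_querySpan _ fun x _ =>
    mul_mem_querySpan (𝒜.outputProb_mem_querySpan x) (indicator_mem_querySpan x b)

theorem le_norm_orbitSum_id [Fintype ((Fin n → F) ≃ₗ[F] (Fin n → F))] {𝒜 : MVAlgorithm F n}
    {b : Fin n → F} {p : ℝ} (h𝒜 : SolvesLinearSystem 𝒜 b p) :
    (Fintype.card ((Fin n → F) ≃ₗ[F] (Fin n → F)) : ℝ) ^ 2 * p ≤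
      ‖orbitSum (LinearMap.id : (Fin n → F) →ₗ[F] (Fin n → F))
        fun f => (solveProb 𝒜 b f : ℂ)‖ := by
  have key : ∀ G C : (Fin n → F) ≃ₗ[F] (Fin n → F),
      p ≤ solveProb 𝒜 b fun v => G (LinearMap.id (R := F) (C v)) := by
    intro G C
    let T : (Fin n → F) ≃ₗ[F] (Fin n → F) := G * C
    have h1 : (fun v => LinearMap.toMatrix' (T : (Fin n → F) →ₗ[F] (Fin n → F)) *ᵥ v) =
        fun v => G (LinearMap.id (R := F) (C v)) := by
      ext1 v
      rw [LinearMap.toMatrix'_mulVec]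
      rfl
    have h2 : IsUnit (LinearMap.toMatrix' (T : (Fin n → F) →ₗ[F] (Fin n → F))) := by
      refine IsUnit.of_mul_eq_one
        (LinearMap.toMatrix' (T.symm : (Fin n → F) →ₗ[F] (Fin n → F))) ?_
      rw [← LinearMap.toMatrix'_comp]
      simp
    have h3 : LinearMap.toMatrix' (T : (Fin n → F) →ₗ[F] (Fin n → F)) *ᵥ T.symm b = b := by
      rw [LinearMap.toMatrix'_mulVec]
      simp
    have h4 := h𝒜 _ _ h2 h3
    rw [← h1]
    exact h4.trans (outputProb_le_solveProb 𝒜 h3)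
  have h5 : orbitSum (LinearMap.id : (Fin n → F) →ₗ[F] (Fin n → F))
      (fun f => (solveProb 𝒜 b f : ℂ)) =
      ((∑ G : (Fin n → F) ≃ₗ[F] (Fin n → F), ∑ C : (Fin n → F) ≃ₗ[F] (Fin n → F),
        solveProb 𝒜 b fun v => G (LinearMap.id (R := F) (C v)) : ℝ) : ℂ) := by
    simp [orbitSum]
  rw [h5, Complex.norm_real]
  refine le_trans ?_ (le_abs_self _)
  calc _ = ∑ _G : (Fin n → F) ≃ₗ[F] (Fin n → F), ∑ _C : (Fin n → F) ≃ₗ[F] (Fin n → F), p := by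
        simp only [Finset.sum_const, Finset.card_univ, nsmul_eq_mul]
        ring
    _ ≤ _ := Finset.sum_le_sum fun G _ => Finset.sum_le_sum fun C _ => key G C

theorem lt_two_mul_queries_of_solvesLinearSystem {𝒜 : MVAlgorithm F n} {b : Fin n → F}
    (hb : b ≠ 0) {p : ℝ} (h𝒜 : SolvesLinearSystem 𝒜 b p) {J : ℕ} (hJ : 8 * (1 / 2 : ℝ) ^ J < p) :
    n < J + (2 * 𝒜.queries + 1) := by
  by_contra! hn
  have : Finite ((Fin n → F) ≃ₗ[F] (Fin n → F)) :=
    Finite.of_injective _ DFunLike.coe_injective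
  have : Fintype ((Fin n → F) ≃ₗ[F] (Fin n → F)) := Fintype.ofFinite _
  obtain ⟨P, hP, hPe⟩ := exists_polynomial_orbitSum (F := F) (solveProb_mem_querySpan 𝒜 b)
  set N : ℝ := (Fintype.card ((Fin n → F) ≃ₗ[F] (Fin n → F)) : ℝ) ^ 2 with hN
  have hNpos : 0 < N := by
    have : 0 < Fintype.card ((Fin n → F) ≃ₗ[F] (Fin n → F)) := Fintype.card_pos
    positivity
  have h1 : ‖P.eval 1‖ ≤ 8 * N * (1 / 2) ^ J := by
    refine norm_eval_one_le_of_geometric (q := Fintype.card F) Fintype.one_lt_card hP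
      fun j _ hj => ?_
    -- The assumption `J + (2t + 1) ≤ n` makes every node an actual kernel dimension.
    obtain ⟨D, hD⟩ := exists_linearMap_finrank_ker_eq F (n := n) (j := j) (by omega)
    have hb := norm_orbitSum_le (F := F) (h := fun f => (solveProb 𝒜 b f : ℂ)) hb
      (fun f => by
        rw [Complex.norm_real, Real.norm_of_nonneg (solveProb_nonneg 𝒜 b f)]
        exact solveProb_le_one 𝒜 b f)
      (fun f hf => by simp [solveProb, hf]) D
    rwa [hPe, hD] at hb
  have h2 := le_norm_orbitSum_id h𝒜
  rw [hPe, LinearMap.ker_id, finrank_bot, pow_zero] at h2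
  nlinarith

end LinearSystem

end QuantumQuery

theorem mainTheorem7 (p : ℝ) (hp : 0 < p) :
    ∃ c : ℝ, 0 < c ∧ ∃ N : ℕ,
      ∀ (F : Type*) [Field F] [Fintype F] [DecidableEq F] (n : ℕ), N ≤ n →
        ∀ b : Fin n → F, b ≠ 0 →
          ∀ 𝒜 : QuantumQuery.MVAlgorithm F n, QuantumQuery.SolvesLinearSystem 𝒜 b p →
            c * (n : ℝ) ≤ (𝒜.queries : ℝ) := by
  obtain ⟨J, hJ⟩ := exists_pow_lt_of_lt_one (show 0 < p / 8 by positivity)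
    (show (1 / 2 : ℝ) < 1 by norm_num)
  -- From `n ≤ J + 2t` and `2J ≤ n` follows `n ≤ 4t`.
  refine ⟨1 / 4, by norm_num, 2 * J, fun F _ _ _ n hn b hb 𝒜 h𝒜 => ?_⟩
  have h := QuantumQuery.lt_two_mul_queries_of_solvesLinearSystem hb h𝒜 (J := J) (by linarith)
  have h' : n ≤ 4 * 𝒜.queries := by omega
  have : (n : ℝ) ≤ 4 * 𝒜.queries := by exact_mod_cast h'
  linarith
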